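/- Let $n\ge 2$. A point cloud $P=(p_1,\dots,p_n)\in\mathbb{R}^{n\times 3}$ consists of $n$ points of $\mathbb{R}^3$. Two point clouds are isomorphic if they have the same number of points and agree up to a permutation of the points, an orthogonal map in $O(3)$ and a translation. Given node features $x_1,\dots,x_n$ in a set $F$, the center set of $P$ is $$\Big\{\tfrac{\sum_i m(x_i)\,p_i}{\sum_i m(x_i)} \;:\; m:F\to\mathbb{R},\ \sum_i m(x_i)\neq 0\Big\},$$ and $P$ is symmetric for these features if its center set has exactly one element. $P$ is $\mathcal{C}$-symmetric if it is symmetric for the features $x_i=\|p_i-\frac1n\sum_k p_k\|$. A DisGNN on point clouds (fully connected, unlabeled, in its maximally expressive form) assigns to all nodes the same initial embedding $h_i^{(0)}\in\mathbb{R}^{d_0}$ and iterates $$h_i^{(l+1)}=f^{(l)}_{\mathrm{update}}\Big(h_i^{(l)},\,f^{(l)}_{\mathrm{aggr}}\big(\{\!\!\{(h_j^{(l)},\|p_i-p_j\|) : 1\le j\le n\}\!\!\}\big)\Big)\in\mathbb{R}^{d_{l+1}};$$ with $L$ layers it outputs $f^{(L)}_{\mathrm{out}}(\{\!\!\{h_i^{(L)}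 : 1\le i\le n\}\!\!\})\in\mathbb{R}^{k_L}$, where all the functions $f^{(l)}_{\mathrm{update}}$, $f^{(l)}_{\mathrm{aggr}}$, $f^{(L)}_{\mathrm{out}}$ are injective (the last two on finite multisets of arbitrary size). $P$ is $\mathcal{D}$-symmetric if it is symmetric for the features $x_i=h_i^{(T)}$, where $T$ is the first round at which the partition of the nodes of $P$ into classes of equal embedding is not changed by one more round. The DisGNN with $L$ layers identifies $P$ if its output on $P$ differs from its output on every point cloud, of any positive size, that is not isomorphic to $P$. Then, for every such DisGNN: 1. if $n\ge 3$, the set of $\mathcal{C}$-symmetric point clouds in $\mathbb{R}^{n\times 3}$ has Lebesgue measure zero; 2. if $n\ge 3$, the set of $\mathcal{D}$-symmetric point clouds in $\mathbb{R}^{n\times 3}$ has Lebesgue measure zero; 3. for every number of layers $L\ge 1$ (in particular for sufficiently many layers for convergence), the set of point clouds in $\mathbb{R}^{n\times 3}$ that the DisGNN with $L$ layers does not identify has Lebesgue measure zero. -/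

import Mathlib

noncomputable section

/-- Unlabeled point clouds of `n` points in `ℝ³`, i.e. the space `ℝ^{n×3}`. Its `volume` is the
product of the Lebesgue measures of the factors, i.e. Lebesgue measure on `ℝ^{n×3}`. -/
abbrev PointCloud (n : ℕ) : Type := Fin n → EuclideanSpace ℝ (Fin 3)

namespace PointCloud

/-- Two point clouds are isomorphic if they have the same number of points and agree up to a
relabeling, an orthogonal map (proper or improper) and a translation. -/
def Isomorphic {n m : ℕ} (P : PointCloud n) (Q : PointCloud m) : Prop :=
  ∃ (e : Fin m ≃ Fin n)
    (R : EuclideanSpace ℝ (Fin 3) ≃ₗᵢ[ℝ] EuclideanSpace ℝ (Fin 3))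
    (t : EuclideanSpace ℝ (Fin 3)), ∀ i, R (P (e i)) + t = Q i

/-- The map `f` on point clouds of all positive sizes identifies `P`: it gives `P` a value different
from the values of all point clouds that are not isomorphic to `P`. -/
def Identifies {S : Type*} (f : (m : ℕ) → PointCloud m → S) {n : ℕ} (P : PointCloud n) : Prop :=
  ∀ (m : ℕ) (Q : PointCloud m), 1 ≤ m → ¬ Isomorphic P Q → f n P ≠ f m Q

/-- The center set of `P` for node features `x`: all barycenters of `P` with masses that are
functions of the node features, of nonzero (but possibly negative) total mass. -/
def centerSet {n : ℕ} {F : Type*} (x : Fin n → F) (P : PointCloud n) :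
    Set (EuclideanSpace ℝ (Fin 3)) :=
  {c | ∃ m : F → ℝ, (∑ i, m (x i)) ≠ 0 ∧ c = (∑ i, m (x i))⁻¹ • ∑ i, m (x i) • P i}

/-- `P` is symmetric for the node features `x`: its center set has exactly one element. -/
def IsSymmetric {n : ℕ} {F : Type*} (x : Fin n → F) (P : PointCloud n) : Prop :=
  (centerSet x P).encard = 1

/-- The geometric center of a point cloud. -/
def center {n : ℕ} (P : PointCloud n) : EuclideanSpace ℝ (Fin 3) :=
  (n : ℝ)⁻¹ • ∑ i, P i

/-- The center distance encoding `𝒞`. -/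
def centerEncoding {n : ℕ} (P : PointCloud n) : Fin n → ℝ :=
  fun i => dist (P i) (center P)

end PointCloud

/-- A DisGNN architecture for unlabeled point clouds: the common initial node embedding, and for each
layer an aggregation, an update and a readout function. Using the layers below `L` and the
readout of index `L` gives the DisGNN with `L` layers. -/
structure DisGNN where
  /-- dimension of the node embeddings after `l` rounds -/
  dim : ℕ → ℕ
  /-- dimension of the aggregated messages in round `l` -/
  aggrDim : ℕ → ℕ
  /-- dimension of the graph embedding read out after `L` rounds -/
  outDim : ℕ → ℕ
  init : Fin (dim 0) → ℝ
  aggr : (l : ℕ) → Multiset ((Fin (dim l) → ℝ) × ℝ) → (Fin (aggrDim l) → ℝ)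
  update : (l : ℕ) → (Fin (dim l) → ℝ) × (Fin (aggrDim l) → ℝ) → (Fin (dim (l + 1)) → ℝ)
  readout : (L : ℕ) → Multiset (Fin (dim L) → ℝ) → (Fin (outDim L) → ℝ)

namespace DisGNN

/-- Maximal expressive form: all intermediate functions are injective. -/
structure IsInjective (M : DisGNN) : Prop where
  aggr : ∀ l, Function.Injective (M.aggr l)
  update : ∀ l, Function.Injective (M.update l)
  readout : ∀ L, Function.Injective (M.readout L)

/-- The node embeddings `h_i^{(l)}` on the fully connected distance graph of `P`: each node receives
messages from all nodes, itself included. -/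
def node (M : DisGNN) {n : ℕ} (P : PointCloud n) : (l : ℕ) → Fin n → (Fin (M.dim l) → ℝ)
  | 0 => fun _ => M.init
  | l + 1 => fun i =>
      M.update l (M.node P l i,
        M.aggr l ((Finset.univ : Finset (Fin n)).val.map
          fun j => (M.node P l j, dist (P i) (P j))))

/-- The graph embedding computed by the DisGNN with `L` layers. -/
def output (M : DisGNN) (L : ℕ) (n : ℕ) (P : PointCloud n) : Fin (M.outDim L) → ℝ :=
  M.readout L ((Finset.univ : Finset (Fin n)).val.map fun i => M.node P L i)

/-- The first layer at which the partition of the nodes of `P` by their embeddings is stable, i.e.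
is not changed by one more round. -/
def stableLayer (M : DisGNN) {n : ℕ} (P : PointCloud n) : ℕ :=
  sInf {l | ∀ i j, M.node P l i = M.node P l j ↔ M.node P (l + 1) i = M.node P (l + 1) j}

/-- The DisGNN encoding `𝒟`: DisGNN is iterated until the partition of the nodes stabilizes. -/
def encoding (M : DisGNN) {n : ℕ} (P : PointCloud n) :
    Fin n → (Fin (M.dim (M.stableLayer P)) → ℝ) :=
  M.node P (M.stableLayer P)

end DisGNN

end

/-! Almost every cloud has distinct distances, since a coincidence of two distances confines some
point to a sphere once the others are fixed. For such a cloud with `3 ≤ n`, one round already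
separates all nodes; likewise center distances are almost surely distinct. Injective features put
every point in the center set, so the cloud is not symmetric. For identification, equal outputs
match nodes with equal distance multisets; the length of an edge is the one nonzero value shared by
the multisets of its endpoints, so all distances agree and the clouds are congruent. -/

open MeasureTheory

section Congruence

variable {ι V : Type*} [NormedAddCommGroup V] [InnerProductSpace ℝ V]

/-- Linear combinations with equal coefficients of two families with the same Gram matrix have the
same norm. -/
theorem norm_linearCombination_eq_of_inner_eq [Fintype ι] {u w : ι → V}
    (h : ∀ i j, inner ℝ (u i) (u j) = inner ℝ (w i) (w j)) (c : ι → ℝ) :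
    ‖Fintype.linearCombination ℝ u c‖ = ‖Fintype.linearCombination ℝ w c‖ := by
  rw [← sq_eq_sq₀ (norm_nonneg _) (norm_nonneg _), ← real_inner_self_eq_norm_sq,
    ← real_inner_self_eq_norm_sq]
  simp only [Fintype.linearCombination_apply, sum_inner, inner_sum, real_inner_smul_left,
    real_inner_smul_right, h]

/-- Two finite families with the same Gram matrix differ by an orthogonal map. -/
theorem exists_linearIsometryEquiv_of_inner_eq [Fintype ι] [FiniteDimensional ℝ V] {u w : ι → V}
    (h : ∀ i j, inner ℝ (u i) (u j) = inner ℝ (w i) (w j)) :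
    ∃ R : V ≃ₗᵢ[ℝ] V, ∀ i, R (u i) = w i := by
  classical
  set A := Fintype.linearCombination ℝ u
  set B := Fintype.linearCombination ℝ w
  have hAB : ∀ c, ‖A c‖ = ‖B c‖ := norm_linearCombination_eq_of_inner_eq h
  obtain ⟨g, hg⟩ := A.rangeRestrict.exists_rightInverse_of_surjective A.range_rangeRestrict
  have hAg : ∀ x : LinearMap.range A, A (g x) = x := fun x =>
    congrArg Subtype.val (LinearMap.congr_fun hg x)
  let f : LinearMap.range A →ₗᵢ[ℝ] V :=
    { toLinearMap := B ∘ₗ g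
      norm_map' := fun x => by
        rw [LinearMap.comp_apply, ← hAB, hAg]
        rfl }
  refine ⟨f.extend.toLinearIsometryEquiv rfl, fun i => ?_⟩
  have hu : A (Pi.single i 1) = u i := by
    simp [A, Fintype.linearCombination_apply_single]
  have hw : B (Pi.single i 1) = w i := by
    simp [B, Fintype.linearCombination_apply_single]
  let x : LinearMap.range A := ⟨u i, Pi.single i 1, hu⟩
  -- `A` and `B` have the same kernel, so the preimage of `u i` chosen by `g` does not matter.
  have hB : B (g x - Pi.single i 1) = 0 := by
    rw [← norm_eq_zero, ← hAB, map_sub, hAg, hu, sub_self, norm_zero]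
  rw [map_sub, hw, sub_eq_zero] at hB
  rw [LinearIsometry.coe_toLinearIsometryEquiv]
  exact (f.extend_apply x).trans hB

/-- Two finite families with the same mutual distances differ by a rigid motion. -/
theorem exists_linearIsometryEquiv_of_dist_eq [Fintype ι] [FiniteDimensional ℝ V] {p q : ι → V}
    (h : ∀ i j, dist (p i) (p j) = dist (q i) (q j)) :
    ∃ (R : V ≃ₗᵢ[ℝ] V) (t : V), ∀ i, R (p i) + t = q i := by
  rcases isEmpty_or_nonempty ι with _ | ⟨⟨o⟩⟩
  · exact ⟨LinearIsometryEquiv.refl ℝ V, 0, isEmptyElim⟩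
  have hinner : ∀ i j, inner ℝ (p i - p o) (p j - p o) = inner ℝ (q i - q o) (q j - q o) := by
    intro i j
    simp only [real_inner_eq_norm_mul_self_add_norm_mul_self_sub_norm_sub_mul_self_div_two,
      sub_sub_sub_cancel_right, ← dist_eq_norm, h]
  obtain ⟨R, hR⟩ := exists_linearIsometryEquiv_of_inner_eq hinner
  refine ⟨R, q o - R (p o), fun i => ?_⟩
  have := hR i
  rw [map_sub] at this
  rw [← add_sub_assoc, add_sub_right_comm, this, sub_add_cancel]

end Congruence

/-- Two finite families with the same multiset of values agree up to relabeling. -/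
theorem exists_equiv_of_map_univ_eq {α β γ : Type*} [Fintype α] [Fintype β] {f : α → γ} {g : β → γ}
    (h : (Finset.univ : Finset α).val.map f = (Finset.univ : Finset β).val.map g) :
    ∃ e : β ≃ α, ∀ b, f (e b) = g b := by
  classical
  have hcard : ∀ c, Nonempty ({b // g b = c} ≃ {a // f a = c}) := fun c => by
    refine ⟨Fintype.equivOfCardEq ?_⟩
    have := congrArg (Multiset.count c) h
    rw [Multiset.count_map, Multiset.count_map] at this
    rw [Fintype.card_subtype, Fintype.card_subtype, Finset.card_def, Finset.card_def,
      Finset.filter_val, Finset.filter_val]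
    simpa only [eq_comm] using this.symm
  exact ⟨Equiv.ofFiberEquiv fun c => (hcard c).some, fun b => Equiv.ofFiberEquiv_map _ b⟩

/-- A measurable set of a finite product is null if all its fibers along one coordinate are. -/
theorem volume_pi_eq_zero_of_fibers {ι : Type*} [Fintype ι] [DecidableEq ι] {X : ι → Type*}
    [∀ i, MeasureSpace (X i)] [∀ i, SigmaFinite (volume : Measure (X i))]
    {S : Set (∀ i, X i)} (hS : MeasurableSet S) (k : ι)
    (h : ∀ P, volume {v | Function.update P k v ∈ S} = 0) : volume S = 0 := by
  have hf : Measurable (S.indicator (1 : (∀ i, X i) → ENNReal)) :=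
    measurable_one.indicator hS
  -- Integrating the indicator over coordinate `k` alone gives the measure of the fiber.
  have key := lintegral_eq_of_lmarginal_eq (μ := fun i => (volume : Measure (X i))) {k} hf
    (measurable_zero : Measurable (0 : (∀ i, X i) → ENNReal)) (by
      rw [lmarginal_singleton, lmarginal_singleton]
      funext P
      have hfib : MeasurableSet {v | Function.update P k v ∈ S} :=
        measurable_update P hS
      have := lintegral_indicator_one (μ := (volume : Measure (X k))) hfib
      rw [h P] at this
      simp only [Pi.zero_apply, lintegral_zero]
      rw [← this]
      rfl)
  rw [volume_pi, ← lintegral_indicator_one hS, key]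
  simp

/-- A hyperplane is a null set. -/
theorem addHaar_setOf_inner_eq {V : Type*} [NormedAddCommGroup V] [InnerProductSpace ℝ V]
    [FiniteDimensional ℝ V] [MeasurableSpace V] [BorelSpace V] (μ : Measure V)
    [μ.IsAddHaarMeasure] {a : V} (ha : a ≠ 0) (r : ℝ) : μ {v | inner ℝ a v = r} = 0 := by
  let s : AffineSubspace ℝ V :=
    (AffineSubspace.mk' r (⊥ : Submodule ℝ ℝ)).comap (innerₛₗ ℝ a).toAffineMap
  have hs : (s : Set V) = {v | inner ℝ a v = r} := by
    ext v
    simp [s, AffineSubspace.mem_mk', sub_eq_zero]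
  rw [← hs]
  refine Measure.addHaar_affineSubspace μ s fun htop => ?_
  have hall : ∀ v, inner ℝ a v = r := fun v => by
    have : v ∈ (s : Set V) := by rw [htop]; trivial
    rwa [hs] at this
  have h0 := hall 0
  rw [inner_zero_right] at h0
  exact ha (inner_self_eq_zero.mp ((hall a).trans h0.symm))

namespace PointCloud

variable {n : ℕ}

/-- Different pairs of points have different distances; in particular the points are distinct. -/
def HasDistinctDistances (P : PointCloud n) : Prop :=
  ∀ i j k l, i ≠ j → dist (P i) (P j) = dist (P k) (P l) → (i = k ∧ j = l) ∨ (i = l ∧ j = k)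

theorem HasDistinctDistances.injective {P : PointCloud n} (hP : HasDistinctDistances P) :
    Function.Injective P := by
  intro i j hij
  by_contra hne
  rcases hP i j i i hne (by rw [hij]) with h | h
  · exact hne h.2.symm
  · exact hne h.2.symm

theorem volume_setOf_dist_eq {i j k l : Fin n} (hij : i ≠ j) (hik : i ≠ k) (hil : i ≠ l) :
    volume {P : PointCloud n | dist (P i) (P j) = dist (P k) (P l)} = 0 := by
  refine volume_pi_eq_zero_of_fibers (IsClosed.measurableSet ?_) i fun P => ?_
  · exact isClosed_eq (by fun_prop) (by fun_prop)
  · simp only [Set.mem_ofPred_eq, Function.update_self, Function.update_of_ne hij.symm,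
      Function.update_of_ne hik.symm, Function.update_of_ne hil.symm]
    exact Measure.addHaar_sphere volume (P j) (dist (P k) (P l))

theorem ae_hasDistinctDistances : ∀ᵐ P : PointCloud n, HasDistinctDistances P := by
  simp only [HasDistinctDistances, ae_all_iff]
  intro i j k l hij
  -- Unless the two pairs coincide, `i` or `j` lies outside `{k, l}` and can be moved alone.
  by_cases hi : i = k ∨ i = l
  · by_cases hj : j = k ∨ j = l
    · refine Filter.Eventually.of_forall fun P h => ?_
      grind
    · push Not at hj
      filter_upwards [compl_mem_ae_iff.mpr (volume_setOf_dist_eq hij.symm hj.1 hj.2)] with P hP h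
      exact absurd ((dist_comm _ _).trans h) hP
  · push Not at hi
    filter_upwards [compl_mem_ae_iff.mpr (volume_setOf_dist_eq hij hi.1 hi.2)] with P hP h
    exact absurd h hP

/-- A point with a feature of its own lies in the center set. -/
theorem mem_centerSet {F : Type*} {x : Fin n → F} (hx : Function.Injective x) (P : PointCloud n)
    (i : Fin n) : P i ∈ centerSet x P := by
  classical
  refine ⟨fun y => if y = x i then 1 else 0, ?_, ?_⟩ <;> simp [hx.eq_iff]

theorem not_isSymmetric_of_injective (hn : 2 ≤ n) {F : Type*} {x : Fin n → F}
    (hx : Function.Injective x) {P : PointCloud n} (hP : Function.Injective P) :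
    ¬ IsSymmetric x P := by
  intro h
  obtain ⟨c, hc⟩ := Set.encard_eq_one.mp h
  have hmem := fun i => hc ▸ mem_centerSet hx P i
  have := hP ((hmem ⟨0, by omega⟩).trans (hmem ⟨1, by omega⟩).symm)
  simp at this

/-- Vectors have equal norms iff their sum and difference are orthogonal. This makes the condition
affine in any third point, which enters only through the center. -/
theorem dist_center_eq_iff (P : PointCloud n) (i j : Fin n) :
    centerEncoding P i = centerEncoding P j ↔
      inner ℝ (P i - P j) (P i + P j - (2 : ℝ) • center P) = 0 := by
  rw [centerEncoding, centerEncoding, dist_eq_norm, dist_eq_norm,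
    show P i - P j = (P i - center P) - (P j - center P) by abel,
    show P i + P j - (2 : ℝ) • center P = (P i - center P) + (P j - center P) by
      rw [two_smul]; abel,
    real_inner_comm, real_inner_add_sub_eq_zero_iff]

theorem center_update (P : PointCloud n) (k : Fin n) (v : EuclideanSpace ℝ (Fin 3)) :
    center (Function.update P k v) = center P + (n : ℝ)⁻¹ • (v - P k) := by
  rw [center, center, ← smul_add, Finset.sum_update_of_mem (Finset.mem_univ k),
    ← Finset.add_sum_erase _ P (Finset.mem_univ k), Finset.sdiff_singleton_eq_erase]
  congr 1
  abel

theorem ae_centerEncoding_injective (hn : 3 ≤ n) :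
    ∀ᵐ P : PointCloud n, Function.Injective (centerEncoding P) := by
  simp only [Function.Injective, ae_all_iff]
  intro i j
  by_cases hij : i = j
  · exact Filter.Eventually.of_forall fun _ _ => hij
  obtain ⟨k, hk⟩ := Fin.exists_ne_and_ne_of_two_lt i j hn
  -- The second condition keeps the normal vector of the hyperplane nonzero.
  have hnull : volume {P : PointCloud n |
      inner ℝ (P i - P j) (P i + P j - (2 : ℝ) • center P) = 0 ∧ P i ≠ P j} = 0 := by
    refine volume_pi_eq_zero_of_fibers (MeasurableSet.inter ?_ ?_) k fun P => ?_
    · refine (isClosed_eq ?_ continuous_const).measurableSet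
      unfold center
      fun_prop
    · exact (isClosed_eq (continuous_apply i) (continuous_apply j)).measurableSet.compl
    · simp only [Set.mem_ofPred_eq, Function.update_of_ne (Ne.symm hk.1),
        Function.update_of_ne (Ne.symm hk.2), center_update]
      by_cases hP : P i = P j
      · simp [hP]
      refine measure_mono_null (fun v hv => ?_) (addHaar_setOf_inner_eq volume (sub_ne_zero.mpr hP)
        (n / 2 * inner ℝ (P i - P j)
          (P i + P j - (2 : ℝ) • center P + (2 * (n : ℝ)⁻¹) • P k)))
      have hn0 : (n : ℝ) ≠ 0 := by positivity
      have h0 := hv.1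
      rw [show P i + P j - (2 : ℝ) • (center P + (n : ℝ)⁻¹ • (v - P k)) =
        (P i + P j - (2 : ℝ) • center P + (2 * (n : ℝ)⁻¹) • P k) - (2 * (n : ℝ)⁻¹) • v by module,
        inner_sub_right, sub_eq_zero, real_inner_smul_right] at h0
      rw [Set.mem_ofPred_eq, h0]
      field_simp
  filter_upwards [compl_mem_ae_iff.mpr hnull, ae_hasDistinctDistances] with P hP hdist heq
  exact absurd ⟨(dist_center_eq_iff P i j).mp heq, hdist.injective.ne hij⟩ hP

/-- The multiset of distances of the `i`-th point to all points. -/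
noncomputable def distances (P : PointCloud n) (i : Fin n) : Multiset ℝ :=
  (Finset.univ : Finset (Fin n)).val.map fun j => dist (P i) (P j)

theorem HasDistinctDistances.distances_injective (hn : 3 ≤ n) {P : PointCloud n}
    (hP : HasDistinctDistances P) : Function.Injective (distances P) := by
  intro i j hij
  by_contra hne
  obtain ⟨k, hk⟩ := Fin.exists_ne_and_ne_of_two_lt i j hn
  obtain ⟨e, he⟩ := exists_equiv_of_map_univ_eq hij.symm
  -- The length of the edge `ik` would also occur at `j`, which is not an endpoint of it.
  rcases hP i k j (e k) (Ne.symm hk.1) (he k).symm with h | h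
  · exact hne h.1
  · exact hk.2 h.2

/-- Point clouds with distinct distances are determined up to isomorphism by the multiset of their
distance multisets. -/
theorem HasDistinctDistances.isomorphic {m : ℕ} {P : PointCloud n} (hP : HasDistinctDistances P)
    {Q : PointCloud m} (e : Fin m ≃ Fin n) (he : ∀ a, distances P (e a) = distances Q a) :
    Isomorphic P Q := by
  have hdist : ∀ a b, dist (P (e a)) (P (e b)) = dist (Q a) (Q b) := by
    intro a b
    by_cases hab : a = b
    · rw [hab, dist_self, dist_self]
    obtain ⟨σ, hσ⟩ := exists_equiv_of_map_univ_eq (he a)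
    obtain ⟨τ, hτ⟩ := exists_equiv_of_map_univ_eq (he b)
    -- The zero distance of a node to itself locates that node.
    have hσa : e a = σ a :=
      hP.injective (dist_eq_zero.mp ((hσ a).trans (dist_self _)))
    have hne : e a ≠ σ b := fun h => hab (σ.injective (hσa.symm.trans h))
    -- Both sides equal the distance from `Q a` to `Q b`, so a single edge of `P` contains both `e
    -- a` and `e b`.
    have heq : dist (P (e a)) (P (σ b)) = dist (P (e b)) (P (τ a)) := by
      rw [hσ, hτ, dist_comm]
    rcases hP _ _ _ _ hne heq with h | h
    · exact absurd (e.injective h.1) hab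
    · rw [← h.2, hσ]
  obtain ⟨R, t, h⟩ := exists_linearIsometryEquiv_of_dist_eq (p := P ∘ e) (q := Q) hdist
  exact ⟨e, R, t, h⟩

end PointCloud

namespace DisGNN

open PointCloud

variable {M : DisGNN} {n m : ℕ}

/-- Later embeddings are at least as fine as earlier ones. -/
theorem IsInjective.node_eq_of_le (hM : M.IsInjective) {P : PointCloud n} {Q : PointCloud m}
    {i : Fin n} {j : Fin m} {l l' : ℕ} (hl : l ≤ l') (h : M.node P l' i = M.node Q l' j) :
    M.node P l i = M.node Q l j := by
  induction l', hl using Nat.le_induction with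
  | base => exact h
  | succ l' _ ih => exact ih (congrArg Prod.fst (hM.update l' h))

theorem IsInjective.distances_eq (hM : M.IsInjective) {P : PointCloud n} {Q : PointCloud m}
    {i : Fin n} {j : Fin m} {l : ℕ} (hl : 1 ≤ l) (h : M.node P l i = M.node Q l j) :
    distances P i = distances Q j := by
  -- The messages of the first round contain the distance multiset.
  have h1 := hM.aggr 0 (congrArg Prod.snd (hM.update 0 (hM.node_eq_of_le hl h)))
  have h2 := congrArg (Multiset.map Prod.snd) h1
  rwa [Multiset.map_map, Multiset.map_map] at h2

theorem IsInjective.node_injective (hM : M.IsInjective) (hn : 3 ≤ n) {P : PointCloud n}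
    (hP : HasDistinctDistances P) {l : ℕ} (hl : 1 ≤ l) : Function.Injective (M.node P l) :=
  fun _ _ h => hP.distances_injective hn (hM.distances_eq hl h)

theorem IsInjective.encoding_injective (hM : M.IsInjective) (hn : 3 ≤ n) {P : PointCloud n}
    (hP : HasDistinctDistances P) : Function.Injective (M.encoding P) := by
  -- Nonemptiness is needed because `sInf ∅ = 0` in `ℕ`.
  have hne : {l | ∀ i j, M.node P l i = M.node P l j ↔
      M.node P (l + 1) i = M.node P (l + 1) j}.Nonempty :=
    ⟨1, fun i j => by
      rw [(hM.node_injective hn hP le_rfl).eq_iff, (hM.node_injective hn hP (Nat.le_add_left 1 1)).eq_iff]⟩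
  have hmem := Nat.sInf_mem hne
  -- Injectivity is known only from layer 1 on, so it is taken one layer later and pulled back by
  -- stability.
  have hinj := hM.node_injective hn hP (Nat.le_add_left 1 (M.stableLayer P))
  exact fun i j h => hinj ((hmem i j).mp h)

/-- Matching the node multisets also forces `m = n`; no third point is needed here. -/
theorem IsInjective.identifies (hM : M.IsInjective) {P : PointCloud n}
    (hP : HasDistinctDistances P) {L : ℕ} (hL : 1 ≤ L) : Identifies (M.output L) P := by
  intro m Q _ hPQ h
  obtain ⟨e, he⟩ := exists_equiv_of_map_univ_eq (hM.readout L h)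
  exact hPQ (hP.isomorphic e fun a => hM.distances_eq hL (he a))

end DisGNN

theorem theorem2 (n : ℕ) (hn : 2 ≤ n) (M : DisGNN) (hM : M.IsInjective) :
    (3 ≤ n →
      MeasureTheory.volume
        {P : PointCloud n | PointCloud.IsSymmetric (PointCloud.centerEncoding P) P} = 0) ∧
    (3 ≤ n →
      MeasureTheory.volume
        {P : PointCloud n | PointCloud.IsSymmetric (M.encoding P) P} = 0) ∧
    ∀ L : ℕ, 1 ≤ L →
      MeasureTheory.volume
        {P : PointCloud n | ¬ PointCloud.Identifies (M.output L) P} = 0 := by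
  refine ⟨fun h3 => ?_, fun h3 => ?_, fun L hL => ?_⟩
  · refine measure_eq_zero_iff_ae_notMem.mpr ?_
    filter_upwards [PointCloud.ae_centerEncoding_injective h3, PointCloud.ae_hasDistinctDistances]
      with P hc hd
    exact PointCloud.not_isSymmetric_of_injective hn hc hd.injective
  · refine measure_eq_zero_iff_ae_notMem.mpr ?_
    filter_upwards [PointCloud.ae_hasDistinctDistances] with P hd
    exact PointCloud.not_isSymmetric_of_injective hn (hM.encoding_injective h3 hd) hd.injective
  · refine measure_eq_zero_iff_ae_notMem.mpr ?_
    filter_upwards [PointCloud.ae_hasDistinctDistances] with P hd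
    exact not_not_intro (hM.identifies hd hL)
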